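/- **Setting.** Let $\mathcal X$ be a finite or countably infinite set of uncorrupted inputs, $\mathcal Z$ a set of corrupted inputs, and $\rho$ a map assigning to each $x\in\mathcal X$ a nonempty finite set $\rho(x)\subseteq\mathcal Z$ with $|\rho(x)|\le k$. Let $D$ be a probability distribution on $\mathcal X$ and $c^*:\mathcal X\to\{0,1\}$ a target function. Let $\mathcal H$ be a (possibly infinite) class of functions $\mathcal Z\to\{0,1\}$ with finite VC dimension $\operatorname{VC}(\mathcal H)=\sup\{m:\Pi_{\mathcal H}(m)=2^m\}$, where $\Pi_{\mathcal H}(m)$ is the maximal number of distinct vectors $(h(z_1),\dots,h(z_m))$, $h\in\mathcal H$, over $z_1,\dots,z_m\in\mathcal Z$. A mixture $\tilde h\in\Delta(\mathcal H)$ is given by $T\in\mathbb N$, hypotheses $h_1,\dots,h_T\in\mathcal H$ and weights $\alpha_t\ge 0$ with $\sum_{t=1}^T\alpha_t=1$; its loss is $\mathsf{loss}(\tilde h(z),y)=\sum_{t=1}^T\alpha_t\,\mathbb I\{h_t(z)\ne y\}$. Put $$\operatorname{Risk}(\tilde h)=\mathbb E_{x\sim D}\Big[\max_{z\in\rho(x)}\mathsf{loss}(\tilde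 h(z),c^*(x))\Big],\qquad \widehat{\operatorname{Risk}}(\tilde h)=\frac1{n}\sum_{i=1}^{n}\max_{z\in\rho(x_i)}\mathsf{loss}(\tilde h(z),y_i)$$ for a sample $S=((x_1,y_1),\dots,(x_n,y_n))$ with $x_1,\dots,x_n$ drawn i.i.d. from $D$ and $y_i=c^*(x_i)$. **Theorem.** There is a universal constant $C>0$ such that, in every such setting and for all $\epsilon>0$, $\delta\in(0,1)$ and $k\ge1$, if the sample size $n$ satisfies $$n\ \ge\ \frac{C}{\epsilon^2}\Big(k\log(k)\operatorname{VC}(\mathcal H)+\log\frac1\delta\Big)\qquad\text{with } k\ge 2\text{ and }\big(\operatorname{VC}(\mathcal H)\ge1\text{ or }\delta\le\tfrac12\big),$$ or, without any further restriction on $k$, $\operatorname{VC}(\mathcal H)$ and $\delta$, $$n\ \ge\ \frac{C}{\epsilon^2}\Big(k\log(3k)\operatorname{VC}(\mathcal H)+\log\frac2\delta\Big),$$ then with probability at least $1-\delta$ over the sample, $$\big|\operatorname{Risk}(\tilde h)-\widehat{\operatorname{Risk}}(\tilde h)\big|\le\epsilon\qquad\text{for every }\tilde h\in\Delta(\mathcal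 H)\text{ simultaneously.}$$ -/

import Mathlib

open MeasureTheory

noncomputable section

namespace RobustLearning

/-- The growth function of a binary class `H`: the largest number of labellings that `H` induces on
`m` points. (The supremum is over numbers that are at most `2 ^ m`.) -/
def growth {Z : Type*} (H : Set (Z → Bool)) (m : ℕ) : ℕ :=
  ⨆ z : Fin m → Z, Set.ncard {b : Fin m → Bool | ∃ h ∈ H, ∀ i, b i = h (z i)}

/-- The VC dimension of a binary class, possibly infinite: the supremum of all `m` such that `H`
induces all `2 ^ m` labellings on some `m` points. -/
def vcDim {Z : Type*} (H : Set (Z → Bool)) : ℕ∞ :=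
  ⨆ m ∈ {m : ℕ | growth H m = 2 ^ m}, (m : ℕ∞)

/-- An element of `Δ(H)`: a finite mixture (convex combination) of hypotheses from `H`. -/
structure Mixture {Z : Type*} (H : Set (Z → Bool)) where
  /-- number of hypotheses in the mixture -/
  size : ℕ
  /-- the mixing coefficients -/
  weight : Fin size → ℝ
  /-- the hypotheses that are mixed -/
  hyp : Fin size → Z → Bool
  weight_nonneg : ∀ t, 0 ≤ weight t
  weight_sum : ∑ t, weight t = 1
  hyp_mem : ∀ t, hyp t ∈ H

/-- The zero-one loss of a prediction `y'` against the label `y`. -/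
def zeroOneLoss (y' y : Bool) : ℝ := if y' ≠ y then 1 else 0

/-- The loss of a mixture: the mixture of the zero-one losses. -/
def Mixture.loss {Z : Type*} {H : Set (Z → Bool)} (q : Mixture H) (z : Z) (y : Bool) : ℝ :=
  ∑ t, q.weight t * zeroOneLoss (q.hyp t z) y

/-- The loss of a mixture on the labelled uncorrupted input `(x, y)` under the worst corruption
`z ∈ ρ x`. -/
def Mixture.advLoss {X Z : Type*} {H : Set (Z → Bool)} (q : Mixture H) (ρ : X → Finset Z)
    (hρ : ∀ x, (ρ x).Nonempty) (x : X) (y : Bool) : ℝ :=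
  (ρ x).sup' (hρ x) fun z => q.loss z y

/-- The adversarial risk `E_{x ∼ D} [max_{z ∈ ρ x} loss(q(z), c(x))]`. -/
def Mixture.risk {X Z : Type*} [MeasurableSpace X] {H : Set (Z → Bool)} (q : Mixture H)
    (ρ : X → Finset Z) (hρ : ∀ x, (ρ x).Nonempty) (D : Measure X) (c : X → Bool) : ℝ :=
  ∫ x, q.advLoss ρ hρ x (c x) ∂D

/-- The empirical adversarial risk on a labelled uncorrupted sample `S` of size `n`. -/
def Mixture.empRisk {X Z : Type*} {H : Set (Z → Bool)} (q : Mixture H) (ρ : X → Finset Z)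
    (hρ : ∀ x, (ρ x).Nonempty) {n : ℕ} (S : Fin n → X × Bool) : ℝ :=
  (1 / (n : ℝ)) * ∑ i, q.advLoss ρ hρ (S i).1 (S i).2

/-- The labelled sample `((x₁, c x₁), …, (xₙ, c xₙ))`. -/
def labelledSample {X : Type*} (c : X → Bool) {n : ℕ} (x : Fin n → X) : Fin n → X × Bool :=
  fun i => (x i, c (x i))

/-- For `n` i.i.d. draws from `D`, labelled by `c`, with probability at least `1 - δ` all mixtures
of `H` simultaneously have adversarial risk within `ε` of their empirical adversarial risk. -/
def UniformlyClose {X Z : Type*} [MeasurableSpace X] (H : Set (Z → Bool)) (ρ : X → Finset Z)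
    (hρ : ∀ x, (ρ x).Nonempty) (D : Measure X) (c : X → Bool) (ε δ : ℝ) (n : ℕ) : Prop :=
  ENNReal.ofReal (1 - δ) ≤
    Measure.pi (fun _ : Fin n => D)
      {x | ∀ q : Mixture H,
        |q.risk ρ hρ D c - q.empRisk ρ hρ (labelledSample c x)| ≤ ε}

end RobustLearning

end

/-!
The result holds without the factor `log k`: a sample of size `O((k * VC(H) + log (2 / δ)) / ε ^ 2)`
suffices, and `1 ≤ log (3 * k)`.

The one-sided uniform deviation of the empirical risk from the risk changes by at most `1 / n` when
one sample point changes, so by McDiarmid's inequality (`measureReal_ge_le_of_bounded_differences`)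
it exceeds its mean by `ε / 2` with probability at most `exp (-n ε ^ 2 / 2)`. By symmetrization
(`integral_iSup_deviation_le`), the mean is at most `2 / n` times the Rademacher average of the
adversarial losses `x ↦ max_{z ∈ ρ x} loss (q z, c x)` over all mixtures `q`.

This loss is not linear in `q`, and the class of mixtures is too rich for uniform covers. Still, a
maximum of `k` numbers is `1`-Lipschitz for the Euclidean norm on `ℝᵏ`, so Maurer's vector
contraction inequality (`expect_iSup_contraction`) replaces the maxima by Rademacher sums over all
`n * k` pairs of a sample point and a corruption of it. These sums are linear in `q`, hence at most
their maximum over single hypotheses (`expect_iSup_loss_le`). What is left is the Rademacher average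
of a set family of VC dimension `d` on `N = n * k` points.

It is `O(√(d * N))`, with no logarithm (`expect_sup'_ind_le`). This is Dudley's chaining: if `1 ≤ d`,
a family in which any two sets differ in more than `4⁻ʲ N` points has at most `exp (4 d (j + 1))`
members (`log_card_le_of_separatedAt`), by restriction to a random sample and the Sauer–Shelah
lemma, and passing from scale `j + 1` to scale `j` costs `√(8 d N) * 2⁻ʲ * (j + 2)` by Massart's lemma, which
sums up over `j`.

As `X` is countable, all functions on samples are measurable.
-/

namespace RobustLearning

open Finset BigOperators
open scoped symmDiff

/-! ### Averages over random signs -/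

/-- The sign `±1` encoded by a Boolean. The Rademacher average of `F` is `𝔼 σ : ι → Bool, F σ`, in
which the random signs are `sgn (σ i)`. -/
def sgn (b : Bool) : ℝ := if b then 1 else -1

@[simp] lemma sgn_true : sgn true = 1 := rfl

@[simp] lemma sgn_false : sgn false = -1 := by simp [sgn]

@[simp] lemma sgn_not (b : Bool) : sgn (!b) = -sgn b := by cases b <;> simp

lemma sgn_eq_or (b : Bool) : sgn b = 1 ∨ sgn b = -1 := by cases b <;> simp

lemma expect_bool (F : Bool → ℝ) : 𝔼 b, F b = (F true + F false) / 2 := by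
  rw [Fintype.expect_eq_sum_div_card]
  simp

lemma expect_not {ι : Type*} [Fintype ι] [DecidableEq ι] (F : (ι → Bool) → ℝ) :
    𝔼 σ : ι → Bool, F (fun i => !σ i) = 𝔼 σ : ι → Bool, F σ :=
  Fintype.expect_equiv (Equiv.piCongrRight fun _ => Equiv.boolNot) _ _ fun _ => rfl

lemma expect_fin_succ {α : Type*} [Fintype α] {n : ℕ} (F : (Fin (n + 1) → α) → ℝ) :
    𝔼 σ : Fin (n + 1) → α, F σ = 𝔼 a : α, 𝔼 σ : Fin n → α, F (Fin.cons a σ) := by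
  rw [← Finset.expect_product', univ_product_univ]
  exact (Fintype.expect_equiv (Fin.consEquiv fun _ => α) _ _ fun _ => rfl).symm

/-- The exponential moment of a Rademacher sum is at most that of a Gaussian of the same
variance. -/
lemma expect_exp_sum_sgn_le {ι : Type*} [Fintype ι] [DecidableEq ι] (a : ι → ℝ) :
    𝔼 σ : ι → Bool, Real.exp (∑ i, sgn (σ i) * a i) ≤ Real.exp ((∑ i, a i ^ 2) / 2) := by
  have h : ∑ σ : ι → Bool, Real.exp (∑ i, sgn (σ i) * a i)
      = ∏ i, (2 * Real.cosh (a i)) := by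
    have h2 : ∀ i, 2 * Real.cosh (a i) = ∑ b : Bool, Real.exp (sgn b * a i) := by
      intro i
      simp [Real.cosh_eq]
      ring
    simp_rw [h2, Finset.prod_univ_sum, Fintype.piFinset_univ, Real.exp_sum]
  rw [Fintype.expect_eq_sum_div_card, h, Finset.prod_mul_distrib]
  simp only [prod_const, card_univ, Fintype.card_pi, Fintype.card_bool, Nat.cast_pow,
    Nat.cast_ofNat]
  rw [mul_div_cancel_left₀ _ (by positivity), sum_div, Real.exp_sum]
  exact prod_le_prod (fun i _ => (Real.cosh_pos _).le) fun i _ => Real.cosh_le_exp_half_sq _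

lemma le_sqrt_of_forall_mul_le {E L V : ℝ} (hL : 0 ≤ L) (hV : 0 ≤ V)
    (h : ∀ l : ℝ, 0 < l → l * E ≤ L + l ^ 2 * V / 2) : E ≤ √(2 * V * L) := by
  rcases le_or_gt E 0 with hE | hE
  · exact hE.trans (Real.sqrt_nonneg _)
  rcases hV.eq_or_lt with rfl | hV
  · have := h ((L + 1) / E) (by positivity)
    rw [div_mul_cancel₀ _ hE.ne'] at this
    linarith
  · apply Real.le_sqrt_of_sq_le
    have h1 := h (E / V) (by positivity)
    have h2 : E / V * E = E ^ 2 / V := by ring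
    have h3 : (E / V) ^ 2 * V / 2 = E ^ 2 / V / 2 := by field_simp
    rw [h2, h3] at h1
    have h4 : E ^ 2 / V ≤ 2 * L := by linarith
    rw [div_le_iff₀ hV] at h4
    linarith

/-- Massart's lemma: the maximum of finitely many Rademacher sums. -/
lemma expect_sup'_sum_sgn_le {ι β : Type*} [Fintype ι] [DecidableEq ι] (S : Finset β)
    (hS : S.Nonempty) (v : β → ι → ℝ) {V : ℝ} (hv : ∀ b ∈ S, ∑ i, v b i ^ 2 ≤ V) :
    𝔼 σ : ι → Bool, S.sup' hS (fun b => ∑ i, sgn (σ i) * v b i)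
      ≤ √(2 * V * Real.log #S) := by
  have hcard : (1 : ℝ) ≤ #S := by exact_mod_cast hS.card_pos
  have hL : 0 ≤ Real.log #S := Real.log_nonneg hcard
  have hV : 0 ≤ V := by
    obtain ⟨b, hb⟩ := hS
    exact (sum_nonneg fun i _ => sq_nonneg _).trans (hv b hb)
  refine le_sqrt_of_forall_mul_le hL hV fun l hl => ?_
  set c := Real.log #S + l ^ 2 * V / 2 with hc
  set M : (ι → Bool) → ℝ := fun σ => S.sup' hS (fun b => ∑ i, sgn (σ i) * v b i) with hM
  have hexp : 𝔼 σ : ι → Bool, Real.exp (l * M σ) ≤ Real.exp c := by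
    calc 𝔼 σ : ι → Bool, Real.exp (l * M σ)
        ≤ 𝔼 σ : ι → Bool, ∑ b ∈ S, Real.exp (∑ i, sgn (σ i) * (l * v b i)) := by
          refine expect_le_expect fun σ _ => ?_
          obtain ⟨b, hb, hbM⟩ := exists_mem_eq_sup' hS (fun b => ∑ i, sgn (σ i) * v b i)
          have : l * M σ = ∑ i, sgn (σ i) * (l * v b i) := by
            simp only [hM]
            rw [hbM, mul_sum]
            exact sum_congr rfl fun i _ => by ring
          rw [this]
          exact single_le_sum (f := fun b => Real.exp (∑ i, sgn (σ i) * (l * v b i)))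
            (fun b _ => (Real.exp_pos _).le) hb
      _ = ∑ b ∈ S, 𝔼 σ : ι → Bool, Real.exp (∑ i, sgn (σ i) * (l * v b i)) :=
          expect_sum_comm _ _ _
      _ ≤ ∑ b ∈ S, Real.exp (l ^ 2 * V / 2) := by
          refine sum_le_sum fun b hb => (expect_exp_sum_sgn_le _).trans ?_
          refine Real.exp_le_exp.2 ?_
          simp_rw [mul_pow, ← mul_sum]
          have := mul_le_mul_of_nonneg_left (hv b hb) (sq_nonneg l)
          linarith
      _ = Real.exp c := by
          rw [sum_const, nsmul_eq_mul, hc, Real.exp_add, Real.exp_log (by linarith)]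
  -- Jensen's inequality for `exp`, through its tangent line at `c`
  have hpt : ∀ σ : ι → Bool, l * M σ ≤ Real.exp (l * M σ) * Real.exp (-c) + (c - 1) := by
    intro σ
    have := Real.add_one_le_exp (l * M σ + -c)
    rw [Real.exp_add] at this
    linarith
  calc l * 𝔼 σ : ι → Bool, M σ = 𝔼 σ : ι → Bool, l * M σ := mul_expect _ _ _
    _ ≤ 𝔼 σ : ι → Bool, (Real.exp (l * M σ) * Real.exp (-c) + (c - 1)) :=
        expect_le_expect fun σ _ => hpt σ
    _ = (𝔼 σ : ι → Bool, Real.exp (l * M σ)) * Real.exp (-c) + (c - 1) := by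
        rw [expect_add_distrib, ← expect_mul, Fintype.expect_const]
    _ ≤ Real.exp c * Real.exp (-c) + (c - 1) := by gcongr
    _ = c := by rw [← Real.exp_add]; simp

/-! ### Packing numbers of set families of bounded VC dimension -/

/-- A form of the Sauer–Shelah bound that keeps a free parameter `x`; the choice `x = d / #s` would
give the usual `(e * #s / d) ^ d`. -/
lemma card_mul_pow_le_exp {α : Type*} [DecidableEq α] (𝒜 : Finset (Finset α)) (s : Finset α)
    (hs : ∀ A ∈ 𝒜, A ⊆ s) {d : ℕ} (hd : ∀ t, 𝒜.Shatters t → #t ≤ d) {x : ℝ} (hx : 0 < x)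
    (hx1 : x ≤ 1) : (#𝒜 : ℝ) * x ^ d ≤ Real.exp (x * #s) := by
  have hsub : 𝒜.shatterer ⊆ s.powerset := by
    intro t ht
    obtain ⟨A, hA, htA⟩ := (mem_shatterer.1 ht).exists_superset
    exact mem_powerset.2 (htA.trans (hs A hA))
  calc (#𝒜 : ℝ) * x ^ d ≤ #𝒜.shatterer * x ^ d := by
        have : (#𝒜 : ℝ) ≤ #𝒜.shatterer := by exact_mod_cast card_le_card_shatterer 𝒜
        gcongr
    _ = ∑ t ∈ 𝒜.shatterer, x ^ d := by simp
    _ ≤ ∑ t ∈ 𝒜.shatterer, x ^ #t :=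
        sum_le_sum fun t ht => pow_le_pow_of_le_one hx.le hx1 (hd t (mem_shatterer.1 ht))
    _ ≤ ∑ t ∈ s.powerset, x ^ #t :=
        sum_le_sum_of_subset_of_nonneg hsub fun _ _ _ => by positivity
    _ = (x + 1) ^ #s := by simp [← sum_pow_mul_eq_add_pow]
    _ ≤ Real.exp x ^ #s := by
        gcongr
        exact Real.add_one_le_exp x
    _ = Real.exp (x * #s) := by rw [← Real.exp_nat_mul, mul_comm]

/-- If the members of a family pairwise differ in more than a fraction `δ` of all points, then some
`m` points tell all of them apart as soon as `m` exceeds `2 log (#P) / δ`: uniformly random points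
do so with positive probability. -/
lemma exists_separating_sample {ι : Type*} [Fintype ι] [DecidableEq ι] (P : Finset (Finset ι))
    (hP : 2 ≤ #P) {δ : ℝ} (hδ1 : δ ≤ 1)
    (hsep : ∀ A ∈ P, ∀ B ∈ P, A ≠ B → δ * Fintype.card ι < #(A ∆ B)) {m : ℕ}
    (hm : 2 * Real.log #P < δ * m) :
    ∃ s : Fin m → ι, ∀ A ∈ P, ∀ B ∈ P, A ≠ B → ∃ i, s i ∈ A ∆ B := by
  by_contra! hcon
  have hN : (0 : ℝ) < Fintype.card ι := by
    obtain ⟨A, hA, B, hB, hAB⟩ := one_lt_card.1 hP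
    have : Nonempty ι := by
      by_contra! h
      exact hAB (Subsingleton.elim A B)
    exact_mod_cast Fintype.card_pos
  have hPpos : (0 : ℝ) < #P := by exact_mod_cast (by omega : 0 < #P)
  have hcover : (univ : Finset (Fin m → ι)) ⊆
      P.offDiag.biUnion fun AB => Fintype.piFinset fun _ => (AB.1 ∆ AB.2)ᶜ := by
    intro s _
    obtain ⟨A, hA, B, hB, hAB, h⟩ := hcon s
    simp only [mem_biUnion, mem_offDiag, Fintype.mem_piFinset, mem_compl]
    exact ⟨(A, B), ⟨hA, hB, hAB⟩, h⟩
  have hcount : (Fintype.card ι : ℝ) ^ m ≤ #P ^ 2 * ((1 - δ) * Fintype.card ι) ^ m := by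
    calc (Fintype.card ι : ℝ) ^ m = #(univ : Finset (Fin m → ι)) := by simp
      _ ≤ ∑ AB ∈ P.offDiag, (#(Fintype.piFinset fun _ : Fin m => (AB.1 ∆ AB.2)ᶜ) : ℝ) := by
          exact_mod_cast (card_le_card hcover).trans card_biUnion_le
      _ ≤ ∑ AB ∈ P.offDiag, ((1 - δ) * Fintype.card ι) ^ m := by
          refine sum_le_sum fun AB hAB => ?_
          obtain ⟨hA, hB, hne⟩ := mem_offDiag.1 hAB
          have h := hsep _ hA _ hB hne
          rw [Fintype.card_piFinset, prod_const, card_univ, Fintype.card_fin, card_compl,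
            Nat.cast_pow, Nat.cast_sub (card_le_univ _)]
          refine pow_le_pow_left₀ (sub_nonneg.2 (by exact_mod_cast card_le_univ _)) ?_ m
          linarith
      _ ≤ #P ^ 2 * ((1 - δ) * Fintype.card ι) ^ m := by
          rw [sum_const, nsmul_eq_mul]
          have h1 : 0 ≤ 1 - δ := by linarith
          gcongr
          rw [offDiag_card, sq]
          exact_mod_cast Nat.sub_le _ _
  rw [mul_pow, ← mul_assoc] at hcount
  have h1 : (1 : ℝ) ≤ #P ^ 2 * (1 - δ) ^ m :=
    le_of_mul_le_mul_right (by simpa using hcount) (pow_pos hN m)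
  have h2 : (1 - δ) ^ m ≤ Real.exp (-(δ * m)) := by
    calc (1 - δ) ^ m ≤ Real.exp (-δ) ^ m :=
          pow_le_pow_left₀ (by linarith) (Real.one_sub_le_exp_neg δ) m
      _ = Real.exp (-(δ * m)) := by rw [← Real.exp_nat_mul]; ring_nf
  have h3 : Real.exp (-(δ * m)) < Real.exp (-(2 * Real.log #P)) := Real.exp_lt_exp.2 (by linarith)
  have h4 : (#P : ℝ) ^ 2 * Real.exp (-(2 * Real.log #P)) = 1 := by
    rw [Real.exp_neg, two_mul, Real.exp_add, Real.exp_log hPpos, ← sq]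
    field_simp
  have h5 : (#P : ℝ) ^ 2 * (1 - δ) ^ m < #P ^ 2 * Real.exp (-(2 * Real.log #P)) := by
    have := h2.trans_lt h3
    gcongr
  linarith

/-- Dudley's bound on packing numbers: restricting to a separating sample keeps the number of sets,
and Sauer–Shelah applies on the sample. -/
lemma log_card_le_of_separated {ι : Type*} [Fintype ι] [DecidableEq ι] (P : Finset (Finset ι))
    {d : ℕ} (hd : ∀ t, P.Shatters t → #t ≤ d) {δ : ℝ} (hδ : 0 < δ) (hδ1 : δ ≤ 1)
    (hsep : ∀ A ∈ P, ∀ B ∈ P, A ≠ B → δ * Fintype.card ι < #(A ∆ B)) :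
    Real.log #P ≤ 4 / 3 * (d * Real.log (8 / δ) + 1 / 8) := by
  have hlog8 : 0 ≤ Real.log (8 / δ) := Real.log_nonneg (by rw [le_div_iff₀ hδ]; linarith)
  rcases Nat.lt_or_ge #P 2 with hP | hP
  · have : Real.log #P = 0 := by interval_cases #P <;> simp
    rw [this]
    positivity
  have hPpos : (0 : ℝ) < #P := by exact_mod_cast (by omega : 0 < #P)
  set L := Real.log #P with hL
  set m := ⌊2 * L / δ⌋₊ + 1 with hm
  have hL0 : 0 ≤ L := Real.log_nonneg (by exact_mod_cast (by omega : 1 ≤ #P))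
  have hm1 : 2 * L < δ * m := by
    have := Nat.lt_floor_add_one (2 * L / δ)
    rw [div_lt_iff₀ hδ] at this
    rw [hm]
    push_cast
    linarith
  have hm2 : δ * m ≤ 2 * L + δ := by
    have := Nat.floor_le (show 0 ≤ 2 * L / δ by positivity)
    rw [le_div_iff₀ hδ] at this
    rw [hm]
    push_cast
    linarith
  obtain ⟨s, hs⟩ := exists_separating_sample P hP hδ1 hsep hm1
  set S : Finset ι := univ.image s with hS
  have hinj : Set.InjOn (fun A => A ∩ S) (P : Set (Finset ι)) := by
    intro A hA B hB hAB
    by_contra hne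
    obtain ⟨i, hi⟩ := hs A hA B hB hne
    have hiS : s i ∈ S := mem_image_of_mem _ (mem_univ i)
    have : s i ∈ A ∩ S ↔ s i ∈ B ∩ S := by
      simp only at hAB
      rw [hAB]
    simp only [mem_inter, hiS, and_true] at this
    rw [mem_symmDiff] at hi
    tauto
  set Q := P.image fun A => A ∩ S with hQ
  have hQcard : #Q = #P := card_image_of_injOn hinj
  have hQsub : ∀ A ∈ Q, A ⊆ S := by
    intro A hA
    obtain ⟨B, -, rfl⟩ := mem_image.1 hA
    exact inter_subset_right
  have hQd : ∀ t, Q.Shatters t → #t ≤ d := by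
    intro t ht
    apply hd
    obtain ⟨A, hA, htA⟩ := ht.exists_superset
    intro u hu
    obtain ⟨B, hB, hBu⟩ := ht hu
    obtain ⟨B', hB', rfl⟩ := mem_image.1 hB
    refine ⟨B', hB', ?_⟩
    rw [← hBu, ← inter_assoc, inter_right_comm, inter_eq_left.2 (htA.trans (hQsub A hA))]
  -- with `x = δ / 8` the exponent `x * m` is about `L / 4`
  have hmain := card_mul_pow_le_exp Q S hQsub hQd (x := δ / 8) (by positivity) (by linarith)
  have hSm : (#S : ℝ) ≤ m := by
    have : #S ≤ #(univ : Finset (Fin m)) := card_image_le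
    rw [card_univ, Fintype.card_fin] at this
    exact_mod_cast this
  rw [hQcard] at hmain
  have hx : 0 < (δ / 8) ^ d := by positivity
  have hlog := Real.log_le_log (mul_pos hPpos hx) hmain
  rw [Real.log_exp, Real.log_mul hPpos.ne' hx.ne', Real.log_pow] at hlog
  have hinv : Real.log (δ / 8) = -Real.log (8 / δ) := by rw [← Real.log_inv, inv_div]
  rw [hinv, ← hL] at hlog
  have hSm' : δ / 8 * #S ≤ δ / 8 * m := by gcongr
  linarith

/-! ### Chaining over a set family of bounded VC dimension -/

/-- The indicator vector of a finite set. -/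
def ind {ι : Type*} [DecidableEq ι] (A : Finset ι) (p : ι) : ℝ := if p ∈ A then 1 else 0

lemma sum_ind_sub_sq {ι : Type*} [Fintype ι] [DecidableEq ι] (A B : Finset ι) :
    ∑ p, (ind A p - ind B p) ^ 2 = #(A ∆ B) := by
  have : ∀ p, (ind A p - ind B p) ^ 2 = if p ∈ A ∆ B then 1 else 0 := by
    intro p
    by_cases hA : p ∈ A <;> by_cases hB : p ∈ B <;> simp [ind, mem_symmDiff, hA, hB]
  simp_rw [this]
  simp

/-- The members of `P` are pairwise at Hamming distance more than `4⁻ʲ N`, where `N` is the number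
of points; that is, at Euclidean distance more than `2⁻ʲ √N`. -/
def SeparatedAt {ι : Type*} [Fintype ι] [DecidableEq ι] (j : ℕ) (P : Finset (Finset ι)) : Prop :=
  ∀ A ∈ P, ∀ B ∈ P, A ≠ B → (1 / 4 : ℝ) ^ j * Fintype.card ι < #(A ∆ B)

lemma exists_separated_net {ι : Type*} [Fintype ι] [DecidableEq ι] (j : ℕ)
    (P : Finset (Finset ι)) :
    ∃ Q ⊆ P, SeparatedAt j Q ∧
      ∀ A ∈ P, ∃ B ∈ Q, (#(A ∆ B) : ℝ) ≤ (1 / 4 : ℝ) ^ j * Fintype.card ι := by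
  classical
  obtain ⟨Q, hQ⟩ := (P.powerset.filter fun Q => SeparatedAt j Q).exists_maximal
    ⟨∅, by simp [SeparatedAt]⟩
  obtain ⟨hQP, hQs⟩ := mem_filter.1 hQ.prop
  rw [mem_powerset] at hQP
  refine ⟨Q, hQP, hQs, fun A hA => ?_⟩
  by_contra! hcon
  have hins : SeparatedAt j (insert A Q) := by
    intro B hB C hC hBC
    rcases mem_insert.1 hB with hB' | hB' <;> rcases mem_insert.1 hC with hC' | hC'
    · exact absurd (hB'.trans hC'.symm) hBC
    · exact hB' ▸ hcon C hC'
    · rw [hC', symmDiff_comm]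
      exact hcon B hB'
    · exact hQs B hB' C hC' hBC
  have hAQ : A ∈ Q := hQ.le_of_ge
    (mem_filter.2 ⟨mem_powerset.2 (insert_subset hA hQP), hins⟩) (subset_insert A Q)
    (mem_insert_self A Q)
  have h := hcon A hAQ
  rw [symmDiff_self] at h
  have h0 : (0 : ℝ) ≤ (1 / 4 : ℝ) ^ j * Fintype.card ι := by positivity
  simp only [bot_eq_empty, card_empty, Nat.cast_zero] at h
  linarith

lemma log_card_le_of_separatedAt {ι : Type*} [Fintype ι] [DecidableEq ι] {P : Finset (Finset ι)}
    {d : ℕ} (hd1 : 1 ≤ d) (hd : ∀ t, P.Shatters t → #t ≤ d) {j : ℕ} (hsep : SeparatedAt j P) :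
    Real.log #P ≤ 4 * d * (j + 1) := by
  have h := log_card_le_of_separated P hd (δ := (1 / 4 : ℝ) ^ j) (by positivity)
    (pow_le_one₀ (by norm_num) (by norm_num)) hsep
  have h8 : Real.log (8 / (1 / 4 : ℝ) ^ j) = (3 + 2 * j) * Real.log 2 := by
    have : (8 : ℝ) / (1 / 4 : ℝ) ^ j = 2 ^ (3 + 2 * j) := by
      rw [pow_add, pow_mul]
      norm_num
      field_simp
      rw [← mul_pow]
      norm_num
    rw [this, Real.log_pow]
    push_cast
    ring
  rw [h8] at h
  have hl := Real.log_two_lt_d9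
  have hd1' : (1 : ℝ) ≤ d := by exact_mod_cast hd1
  have hj : (0 : ℝ) ≤ j := j.cast_nonneg
  have h1 : (3 + 2 * (j : ℝ)) * Real.log 2 ≤ (3 + 2 * j) * 0.7 := by
    have : Real.log 2 ≤ 0.7 := by linarith
    gcongr
  have h2 : (d : ℝ) * ((3 + 2 * (j : ℝ)) * Real.log 2) ≤ d * ((3 + 2 * j) * 0.7) := by gcongr
  have h3 : (0 : ℝ) ≤ d * j := by positivity
  linarith

/-- One chain link is added per step: the sets separated at scale `j + 1` are moved to a net at
scale `j`, and the increments are handled by Massart's lemma. The partial sums of the series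
`∑ 2⁻ⁱ (i + 2) = 6` have the closed form `6 - 2⁻ʲ (2 j + 6)`. -/
lemma expect_sup'_le_of_separatedAt {ι : Type*} [Fintype ι] [DecidableEq ι] {d : ℕ} (hd1 : 1 ≤ d)
    (j : ℕ) : ∀ (P : Finset (Finset ι)) (hP : P.Nonempty), (∀ t, P.Shatters t → #t ≤ d) →
      SeparatedAt j P →
      𝔼 σ : ι → Bool, P.sup' hP (fun A => ∑ p, sgn (σ p) * ind A p)
        ≤ √(8 * d * Fintype.card ι) * (6 - (1 / 2) ^ j * (2 * j + 6)) := by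
  induction j with
  | zero =>
    intro P hP _ hsep
    have hcard : #P ≤ 1 := by
      refine card_le_one.2 fun A hA B hB => ?_
      by_contra hne
      have h := hsep A hA B hB hne
      have h2 : (#(A ∆ B) : ℝ) ≤ Fintype.card ι := by exact_mod_cast card_le_univ _
      rw [pow_zero, one_mul] at h
      linarith
    have hcard : #P = 1 := le_antisymm hcard hP.card_pos
    refine (expect_sup'_sum_sgn_le P hP ind fun A hA =>
      single_le_sum (f := fun A => ∑ p, ind A p ^ 2)
        (fun A _ => sum_nonneg fun p _ => sq_nonneg _) hA).trans ?_
    simp [hcard]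
  | succ j ih =>
    intro P hP hd hsep
    obtain ⟨Q, hQP, hQ, hcov⟩ := exists_separated_net j P
    have hQd : ∀ t, Q.Shatters t → #t ≤ d := fun t ht => hd t (ht.mono_left hQP)
    choose! π hπQ hπ using hcov
    have hQne : Q.Nonempty := ⟨π hP.choose, hπQ _ hP.choose_spec⟩
    have hinc := expect_sup'_sum_sgn_le P hP (fun A p => ind A p - ind (π A) p)
      (V := (1 / 4 : ℝ) ^ j * Fintype.card ι) fun A hA => by
        rw [sum_ind_sub_sq]
        exact hπ A hA
    have hL := log_card_le_of_separatedAt hd1 hd hsep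
    have hroot : √(2 * ((1 / 4 : ℝ) ^ j * Fintype.card ι) * Real.log #P)
        ≤ √(8 * d * Fintype.card ι) * ((1 / 2) ^ j * (j + 2)) := by
      have hj : (0 : ℝ) ≤ (1 / 2) ^ j * (j + 2) := by positivity
      rw [← Real.sqrt_sq hj, ← Real.sqrt_mul (by positivity)]
      refine Real.sqrt_le_sqrt ?_
      calc 2 * ((1 / 4 : ℝ) ^ j * Fintype.card ι) * Real.log #P
          ≤ 2 * ((1 / 4 : ℝ) ^ j * Fintype.card ι) * (4 * d * ((j + 1 : ℕ) + 1)) := by gcongr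
        _ = 8 * d * Fintype.card ι * ((1 / 4) ^ j * (j + 2)) := by
            push_cast
            ring
        _ ≤ 8 * d * Fintype.card ι * ((1 / 4) ^ j * (j + 2) ^ 2) := by
            gcongr
            nlinarith [(j.cast_nonneg : (0 : ℝ) ≤ j)]
        _ = 8 * d * Fintype.card ι * ((1 / 2) ^ j * (j + 2)) ^ 2 := by
            rw [mul_pow, ← pow_mul, mul_comm j 2, pow_mul]
            norm_num
    calc 𝔼 σ : ι → Bool, P.sup' hP (fun A => ∑ p, sgn (σ p) * ind A p)
        ≤ 𝔼 σ : ι → Bool, (Q.sup' hQne (fun A => ∑ p, sgn (σ p) * ind A p)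
            + P.sup' hP (fun A => ∑ p, sgn (σ p) * (ind A p - ind (π A) p))) := by
          refine expect_le_expect fun σ _ => sup'_le _ _ fun A hA => ?_
          have h1 := le_sup' (fun A => ∑ p, sgn (σ p) * ind A p) (hπQ A hA)
          have h2 := le_sup' (fun A => ∑ p, sgn (σ p) * (ind A p - ind (π A) p)) hA
          have h3 : ∑ p, sgn (σ p) * (ind A p - ind (π A) p)
              = ∑ p, sgn (σ p) * ind A p - ∑ p, sgn (σ p) * ind (π A) p := by
            simp_rw [mul_sub, sum_sub_distrib]
          simp only [h3] at h1 h2 ⊢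
          linarith
      _ ≤ √(8 * d * Fintype.card ι) * (6 - (1 / 2) ^ j * (2 * j + 6))
            + √(8 * d * Fintype.card ι) * ((1 / 2) ^ j * (j + 2)) := by
          rw [expect_add_distrib]
          exact add_le_add (ih Q hQne hQd hQ) (hinc.trans hroot)
      _ = √(8 * d * Fintype.card ι)
            * (6 - (1 / 2) ^ (j + 1) * (2 * ((j + 1 : ℕ) : ℝ) + 6)) := by
          push_cast
          ring

/-- The Rademacher average of a set family of VC dimension at most `d` on `N` points is
`O(√(d N))`. -/
lemma expect_sup'_ind_le {ι : Type*} [Fintype ι] [DecidableEq ι] {d : ℕ} (P : Finset (Finset ι))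
    (hP : P.Nonempty) (hd : ∀ t, P.Shatters t → #t ≤ d) :
    𝔼 σ : ι → Bool, P.sup' hP (fun A => ∑ p, sgn (σ p) * ind A p)
      ≤ 17 * √(d * Fintype.card ι) := by
  rcases Nat.eq_zero_or_pos d with rfl | hd1
  · have hsub : P.shatterer ⊆ {∅} := by
      intro t ht
      have := hd t (mem_shatterer.1 ht)
      simpa using this
    have hcard : #P = 1 :=
      le_antisymm ((card_le_card_shatterer P).trans (card_le_card hsub)) hP.card_pos
    refine (expect_sup'_sum_sgn_le P hP ind fun A hA =>
      single_le_sum (f := fun A => ∑ p, ind A p ^ 2)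
        (fun A _ => sum_nonneg fun p _ => sq_nonneg _) hA).trans ?_
    simp [hcard]
  -- beyond the scale at which `4⁻ʲ N < 1`, any family is separated
  obtain ⟨j, hj⟩ := pow_unbounded_of_one_lt (Fintype.card ι : ℝ) (by norm_num : (1 : ℝ) < 4)
  have hsep : SeparatedAt j P := by
    intro A _ B _ hne
    have h1 : (1 : ℝ) ≤ #(A ∆ B) := by
      have : (A ∆ B).Nonempty := by
        rw [nonempty_iff_ne_empty]
        exact fun h => hne (symmDiff_eq_bot.1 h)
      exact_mod_cast this.card_pos
    have h2 : (1 / 4 : ℝ) ^ j * Fintype.card ι < 1 := by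
      rw [one_div, inv_pow, inv_mul_lt_iff₀ (by positivity)]
      linarith
    linarith
  refine (expect_sup'_le_of_separatedAt hd1 j P hP hd hsep).trans ?_
  have h8 : √8 ≤ 17 / 6 := Real.sqrt_le_iff.2 ⟨by norm_num, by norm_num⟩
  have h0 : (0 : ℝ) ≤ (1 / 2) ^ j * (2 * j + 6) := by positivity
  rw [mul_assoc, Real.sqrt_mul (by norm_num)]
  have h3 := Real.sqrt_nonneg ((d : ℝ) * Fintype.card ι)
  calc √8 * √(d * Fintype.card ι) * (6 - (1 / 2) ^ j * (2 * j + 6))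
      ≤ √8 * √(d * Fintype.card ι) * 6 := by
        gcongr
        linarith
    _ ≤ 17 / 6 * √(d * Fintype.card ι) * 6 := by gcongr
    _ = 17 * √(d * Fintype.card ι) := by ring

/-! ### Vector contraction for Rademacher averages -/

lemma expect_sum_sgn_sq {k : ℕ} (v : Fin k → ℝ) :
    𝔼 σ : Fin k → Bool, (∑ j, sgn (σ j) * v j) ^ 2 = ∑ j, v j ^ 2 := by
  induction k with
  | zero => simp
  | succ k ih =>
    rw [expect_fin_succ, expect_bool, ← expect_add_distrib, expect_div, Fin.sum_univ_succ,
      ← ih fun j => v j.succ, ← Fintype.expect_const (ι := Fin k → Bool) (v 0 ^ 2),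
      ← expect_add_distrib]
    refine expect_congr rfl fun σ _ => ?_
    simp only [Fin.sum_univ_succ, Fin.cons_zero, Fin.cons_succ, sgn_true, sgn_false]
    ring

lemma expect_sum_sgn_pow_four_le {k : ℕ} (v : Fin k → ℝ) :
    𝔼 σ : Fin k → Bool, (∑ j, sgn (σ j) * v j) ^ 4 ≤ 3 * (∑ j, v j ^ 2) ^ 2 := by
  induction k with
  | zero => simp
  | succ k ih =>
    have h2 := expect_sum_sgn_sq fun j => v (Fin.succ j)
    have h4 := ih fun j => v j.succ
    have hrec : 𝔼 σ : Fin (k + 1) → Bool, (∑ j, sgn (σ j) * v j) ^ 4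
        = v 0 ^ 4 + 6 * v 0 ^ 2 * 𝔼 σ : Fin k → Bool, (∑ j, sgn (σ j) * v j.succ) ^ 2
          + 𝔼 σ : Fin k → Bool, (∑ j, sgn (σ j) * v j.succ) ^ 4 := by
      rw [expect_fin_succ, expect_bool, ← expect_add_distrib, expect_div, mul_expect,
        ← Fintype.expect_const (ι := Fin k → Bool) (v 0 ^ 4), ← expect_add_distrib,
        ← expect_add_distrib]
      refine expect_congr rfl fun σ _ => ?_
      simp only [Fin.sum_univ_succ, Fin.cons_zero, Fin.cons_succ, sgn_true, sgn_false]
      ring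
    rw [hrec, h2, Fin.sum_univ_succ]
    nlinarith [sq_nonneg (v 0 ^ 2)]

/-- Khintchine's inequality in `L¹`, with a constant that is not optimal. It follows from the second
and fourth moments through `12 V² s² - s⁴ ≤ 16 V³ |s|`. -/
lemma sqrt_sum_sq_le_expect_abs {k : ℕ} (v : Fin k → ℝ) :
    √(∑ j, v j ^ 2) ≤ 𝔼 σ : Fin k → Bool, 2 * |∑ j, sgn (σ j) * v j| := by
  set V := √(∑ j, v j ^ 2) with hV
  have hV2 : V ^ 2 = ∑ j, v j ^ 2 := Real.sq_sqrt (sum_nonneg fun j _ => sq_nonneg _)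
  have hV0 : 0 ≤ V := Real.sqrt_nonneg _
  have hpt : ∀ s : ℝ, 12 * V ^ 2 * s ^ 2 - s ^ 4 ≤ 8 * V ^ 3 * (2 * |s|) := by
    intro s
    have h : 0 ≤ |s| * ((|s| - 2 * V) ^ 2 * (|s| + 4 * V)) := by positivity
    rw [← sq_abs s, ← (Even.pow_abs (by decide : Even 4) s)]
    nlinarith
  have hmean := expect_le_expect (s := (univ : Finset (Fin k → Bool)))
    fun σ _ => hpt (∑ j, sgn (σ j) * v j)
  rw [expect_sub_distrib, ← mul_expect, ← mul_expect, expect_sum_sgn_sq, ← hV2] at hmean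
  have h4 := expect_sum_sgn_pow_four_le v
  rw [← hV2] at h4
  rcases hV0.eq_or_lt with h0 | h0
  · rw [← h0]
    exact expect_nonneg fun _ _ => by positivity
  · have h3 : 0 < V ^ 3 := by positivity
    refine le_of_mul_le_mul_left ?_ h3
    nlinarith [pow_pos h0 4]

/-- A real function with bounded range. -/
def BoundedFun {T : Type*} (f : T → ℝ) : Prop := ∃ B, ∀ t, |f t| ≤ B

lemma BoundedFun.add {T : Type*} {f g : T → ℝ} (hf : BoundedFun f) (hg : BoundedFun g) :
    BoundedFun fun t => f t + g t := by
  obtain ⟨B, hB⟩ := hf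
  obtain ⟨B', hB'⟩ := hg
  exact ⟨B + B', fun t => (abs_add_le _ _).trans (add_le_add (hB t) (hB' t))⟩

lemma BoundedFun.const_mul {T : Type*} {f : T → ℝ} (hf : BoundedFun f) (a : ℝ) :
    BoundedFun fun t => a * f t := by
  obtain ⟨B, hB⟩ := hf
  refine ⟨|a| * B, fun t => ?_⟩
  rw [abs_mul]
  exact mul_le_mul_of_nonneg_left (hB t) (abs_nonneg a)

lemma BoundedFun.sum {T ι : Type*} {s : Finset ι} {f : ι → T → ℝ}
    (hf : ∀ i ∈ s, BoundedFun (f i)) : BoundedFun fun t => ∑ i ∈ s, f i t := by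
  choose! B hB using hf
  exact ⟨∑ i ∈ s, B i, fun t =>
    (abs_sum_le_sum_abs _ _).trans (sum_le_sum fun i hi => hB i hi t)⟩

lemma BoundedFun.bddAbove {T : Type*} {f : T → ℝ} (hf : BoundedFun f) :
    BddAbove (Set.range f) := by
  obtain ⟨B, hB⟩ := hf
  exact ⟨B, by rintro _ ⟨t, rfl⟩; exact (le_abs_self _).trans (hB t)⟩

/-- The contraction step for a single sign: if `ψ` is `1`-Lipschitz in the Euclidean distance of the
vectors `v`, one sign in front of `ψ` is traded for independent signs in front of the coordinates
of `v`. -/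
lemma expect_iSup_contraction_step {T : Type*} [Nonempty T] {k : ℕ} {ψ g : T → ℝ}
    {v : T → Fin k → ℝ} (hv : ∀ j, BoundedFun fun t => v t j) (hg : BoundedFun g)
    (hL : ∀ s t, ψ s - ψ t ≤ √(∑ j, (v s j - v t j) ^ 2)) :
    𝔼 b, ⨆ t, (sgn b * ψ t + g t)
      ≤ 𝔼 σ : Fin k → Bool, ⨆ t, (2 * ∑ j, sgn (σ j) * v t j + g t) := by
  set Y : (Fin k → Bool) → T → ℝ := fun σ t => 2 * ∑ j, sgn (σ j) * v t j with hY
  set R := 𝔼 σ : Fin k → Bool, ⨆ t, (Y σ t + g t) with hR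
  have hbdd : ∀ σ, BddAbove (Set.range fun t => Y σ t + g t) := fun σ =>
    (((BoundedFun.sum fun j _ => (hv j).const_mul _).const_mul 2).add hg).bddAbove
  have hYneg : ∀ σ t, Y (fun j => !σ j) t = -Y σ t := by
    intro σ t
    simp [hY]
  have hpair : ∀ s t, (ψ s + g s) + (-ψ t + g t) ≤ 2 * R := by
    intro s t
    calc (ψ s + g s) + (-ψ t + g t) = (ψ s - ψ t) + (g s + g t) := by ring
      _ ≤ 𝔼 σ : Fin k → Bool, (2 * |∑ j, sgn (σ j) * (v s j - v t j)| + (g s + g t)) := by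
          rw [expect_add_distrib, Fintype.expect_const]
          exact add_le_add_left ((hL s t).trans (sqrt_sum_sq_le_expect_abs _)) _
      _ ≤ 𝔼 σ : Fin k → Bool,
            ((⨆ t, (Y σ t + g t)) + ⨆ t, (Y (fun j => !σ j) t + g t)) := by
          refine expect_le_expect fun σ _ => ?_
          have hdiff : 2 * |∑ j, sgn (σ j) * (v s j - v t j)| = |Y σ s - Y σ t| := by
            rw [hY, ← mul_sub, abs_mul, ← sum_sub_distrib, abs_two]
            simp_rw [mul_sub]
          rw [hdiff]
          have h1 := le_ciSup (hbdd σ) s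
          have h2 := le_ciSup (hbdd σ) t
          have h3 := le_ciSup (hbdd fun j => !σ j) s
          have h4 := le_ciSup (hbdd fun j => !σ j) t
          simp only [hYneg] at h1 h2 h3 h4 ⊢
          rcases abs_cases (Y σ s - Y σ t) with ⟨h, -⟩ | ⟨h, -⟩ <;> rw [h] <;> linarith
      _ = 2 * R := by
          rw [expect_add_distrib, expect_not fun σ => ⨆ t, (Y σ t + g t), ← hR]
          ring
  have h1 : (⨆ s, (ψ s + g s)) + ⨆ t, (-ψ t + g t) ≤ 2 * R := by
    rw [← le_sub_iff_add_le]
    refine ciSup_le fun s => ?_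
    rw [le_sub_comm]
    refine ciSup_le fun t => ?_
    linarith [hpair s t]
  rw [expect_bool]
  simp only [sgn_true, sgn_false, one_mul, neg_one_mul]
  linarith

/-- Maurer's vector contraction inequality, with the constant `2` instead of `√2`. -/
lemma expect_iSup_contraction {T : Type*} [Nonempty T] {k n : ℕ} {ψ : Fin n → T → ℝ}
    {v : Fin n → T → Fin k → ℝ} {g : T → ℝ} (hψ : ∀ i, BoundedFun (ψ i))
    (hv : ∀ i j, BoundedFun fun t => v i t j) (hg : BoundedFun g)
    (hL : ∀ i s t, ψ i s - ψ i t ≤ √(∑ j, (v i s j - v i t j) ^ 2)) :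
    𝔼 σ : Fin n → Bool, ⨆ t, (∑ i, sgn (σ i) * ψ i t + g t)
      ≤ 𝔼 τ : Fin n → Fin k → Bool, ⨆ t, (∑ i, 2 * ∑ j, sgn (τ i j) * v i t j + g t) := by
  induction n generalizing g with
  | zero => simp
  | succ n ih =>
    rw [expect_fin_succ, expect_fin_succ]
    calc 𝔼 b : Bool, 𝔼 σ : Fin n → Bool,
          ⨆ t, (∑ i, sgn ((Fin.cons b σ : Fin (n + 1) → Bool) i) * ψ i t + g t)
        ≤ 𝔼 b : Bool, 𝔼 τ : Fin n → Fin k → Bool,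
            ⨆ t, (∑ i, 2 * ∑ j, sgn (τ i j) * v i.succ t j + (sgn b * ψ 0 t + g t)) := by
          refine expect_le_expect fun b _ => ?_
          refine le_trans (le_of_eq ?_) (ih (fun i => hψ i.succ) (fun i => hv i.succ)
            (((hψ 0).const_mul (sgn b)).add hg) fun i => hL i.succ)
          refine expect_congr rfl fun σ _ => iSup_congr fun t => ?_
          rw [Fin.sum_univ_succ]
          simp only [Fin.cons_zero, Fin.cons_succ]
          ring
      _ = 𝔼 τ : Fin n → Fin k → Bool, 𝔼 b : Bool,
            ⨆ t, (sgn b * ψ 0 t + (∑ i, 2 * ∑ j, sgn (τ i j) * v i.succ t j + g t)) := by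
          rw [expect_comm]
          refine expect_congr rfl fun τ _ => expect_congr rfl fun b _ => iSup_congr fun t => ?_
          ring
      _ ≤ 𝔼 τ : Fin n → Fin k → Bool, 𝔼 τ₀ : Fin k → Bool,
            ⨆ t, (2 * ∑ j, sgn (τ₀ j) * v 0 t j
              + (∑ i, 2 * ∑ j, sgn (τ i j) * v i.succ t j + g t)) := by
          refine expect_le_expect fun τ _ => expect_iSup_contraction_step (hv 0) ?_ (hL 0)
          exact (BoundedFun.sum fun i _ =>
            (BoundedFun.sum fun j _ => (hv i.succ j).const_mul _).const_mul 2).add hg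
      _ = 𝔼 τ₀ : Fin k → Bool, 𝔼 τ : Fin n → Fin k → Bool,
            ⨆ t, (∑ i, 2 * ∑ j, sgn ((Fin.cons τ₀ τ : Fin (n + 1) → Fin k → Bool) i j) * v i t j
              + g t) := by
          rw [expect_comm]
          refine expect_congr rfl fun τ₀ _ => expect_congr rfl fun τ _ => iSup_congr fun t => ?_
          rw [Fin.sum_univ_succ]
          simp only [Fin.cons_zero, Fin.cons_succ]
          ring

/-! ### Integrals of bounded functions over i.i.d. samples from a countable space -/

lemma BoundedFun.integrable {Ω : Type*} [MeasurableSpace Ω] [DiscreteMeasurableSpace Ω]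
    {μ : Measure Ω} [IsFiniteMeasure μ] {f : Ω → ℝ} (hf : BoundedFun f) : Integrable f μ := by
  obtain ⟨B, hB⟩ := hf
  exact Integrable.of_bound (Measurable.of_discrete (f := f)).aestronglyMeasurable B
    (Filter.Eventually.of_forall hB)

lemma abs_integral_le_of_abs_le {Ω : Type*} [MeasurableSpace Ω] {μ : Measure Ω}
    [IsProbabilityMeasure μ] {f : Ω → ℝ} {B : ℝ} (hB : ∀ x, |f x| ≤ B) : |∫ x, f x ∂μ| ≤ B := by
  simpa using norm_integral_le_of_norm_le_const (μ := μ) (f := f) (Filter.Eventually.of_forall hB)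

lemma BoundedFun.exp {T : Type*} {f : T → ℝ} (hf : BoundedFun f) :
    BoundedFun fun t => Real.exp (f t) := by
  obtain ⟨B, hB⟩ := hf
  refine ⟨Real.exp B, fun t => ?_⟩
  rw [Real.abs_exp]
  exact Real.exp_le_exp.2 ((le_abs_self _).trans (hB t))

lemma BoundedFun.sub_const {T : Type*} {f : T → ℝ} (hf : BoundedFun f) (a : ℝ) :
    BoundedFun fun t => f t - a := by
  simpa [sub_eq_add_neg] using hf.add (g := fun _ => -a) ⟨|-a|, fun _ => le_rfl⟩

lemma integral_comp_of_measurePreserving {Ω Ω' : Type*} [MeasurableSpace Ω] [MeasurableSpace Ω']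
    [DiscreteMeasurableSpace Ω'] {μ : Measure Ω} {ν : Measure Ω'} {φ : Ω → Ω'}
    (hφ : MeasurePreserving φ μ ν) (F : Ω' → ℝ) : ∫ x, F (φ x) ∂μ = ∫ y, F y ∂ν := by
  rw [← hφ.map_eq, integral_map hφ.measurable.aemeasurable
    (Measurable.of_discrete (f := F)).aestronglyMeasurable]

section Countable

variable {X : Type*} [Countable X] [MeasurableSpace X] [MeasurableSingletonClass X]

lemma integral_pi_succ (D : Measure X) [IsProbabilityMeasure D] {n : ℕ}
    {F : (Fin (n + 1) → X) → ℝ} (hF : BoundedFun F) :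
    ∫ x, F x ∂Measure.pi (fun _ : Fin (n + 1) => D)
      = ∫ a, ∫ x, F (Fin.cons a x) ∂Measure.pi (fun _ : Fin n => D) ∂D := by
  have hmp := (measurePreserving_piFinSuccAbove (fun _ : Fin (n + 1) => D) 0)
  have h := integral_comp_of_measurePreserving hmp
    fun p : X × (Fin n → X) => F (Fin.cons p.1 p.2)
  have hcons : ∀ x : Fin (n + 1) → X, F (Fin.cons
      (MeasurableEquiv.piFinSuccAbove (fun _ => X) 0 x).1
      (MeasurableEquiv.piFinSuccAbove (fun _ => X) 0 x).2) = F x := by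
    intro x
    congr 1
    exact Fin.cons_self_tail x
  simp_rw [hcons] at h
  rw [h, integral_prod]
  obtain ⟨B, hB⟩ := hF
  exact BoundedFun.integrable ⟨B, fun p => hB _⟩

/-! ### McDiarmid's inequality -/

/-- Hoeffding's lemma for a function of oscillation at most `c`. -/
lemma integral_exp_le_of_oscillation_le {Ω : Type*} [MeasurableSpace Ω]
    [DiscreteMeasurableSpace Ω] (μ : Measure Ω) [IsProbabilityMeasure μ] {g : Ω → ℝ} {c : ℝ}
    (hc : ∀ a b, g a - g b ≤ c) (l : ℝ) :
    ∫ a, Real.exp (l * (g a - ∫ b, g b ∂μ)) ∂μ ≤ Real.exp (l ^ 2 * c ^ 2 / 8) := by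
  have hne : Nonempty Ω := μ.nonempty_of_neZero
  obtain ⟨a₀⟩ := hne
  have hbdd : BddBelow (Set.range g) := ⟨g a₀ - c, by rintro _ ⟨b, rfl⟩; linarith [hc a₀ b]⟩
  have hmem : ∀ a, g a ∈ Set.Icc (⨅ b, g b) ((⨅ b, g b) + c) := by
    intro a
    refine ⟨ciInf_le hbdd a, ?_⟩
    have : Nonempty Ω := ⟨a₀⟩
    have : g a - c ≤ ⨅ b, g b := le_ciInf fun b => by linarith [hc a b]
    linarith
  have h := (ProbabilityTheory.hasSubgaussianMGF_of_mem_Icc (μ := μ)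
    (Measurable.of_discrete (f := g)).aemeasurable (Filter.Eventually.of_forall hmem)).mgf_le l
  rw [ProbabilityTheory.mgf] at h
  refine h.trans (Real.exp_le_exp.2 (le_of_eq ?_))
  push_cast
  simp only [add_sub_cancel_left, Real.norm_eq_abs, div_pow, sq_abs]
  ring

/-- The exponential moment bound behind McDiarmid's inequality: Hoeffding's lemma is applied to one
coordinate at a time. -/
lemma integral_exp_le_of_bounded_differences (D : Measure X) [IsProbabilityMeasure D] {n : ℕ}
    {f : (Fin n → X) → ℝ} (hf : BoundedFun f) {c : ℝ}
    (hc : ∀ x i a, f x - f (Function.update x i a) ≤ c) (l : ℝ) :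
    ∫ x, Real.exp (l * (f x - ∫ y, f y ∂Measure.pi (fun _ => D))) ∂Measure.pi (fun _ => D)
      ≤ Real.exp (n * (l ^ 2 * c ^ 2 / 8)) := by
  induction n with
  | zero =>
    have hconst : f = fun _ => f default := funext fun x => by rw [Subsingleton.elim x default]
    rw [hconst]
    simp
  | succ n ih =>
    set g : X → ℝ := fun a => ∫ x, f (Fin.cons a x) ∂Measure.pi (fun _ : Fin n => D) with hg
    set E := ∫ y, f y ∂Measure.pi (fun _ : Fin (n + 1) => D) with hE
    have hEg : E = ∫ a, g a ∂D := integral_pi_succ D hf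
    have hfa : ∀ a, BoundedFun fun x : Fin n → X => f (Fin.cons a x) := fun a => by
      obtain ⟨B, hB⟩ := hf
      exact ⟨B, fun x => hB _⟩
    have hgb : BoundedFun g := by
      obtain ⟨B, hB⟩ := hf
      exact ⟨B, fun a => abs_integral_le_of_abs_le fun x => hB _⟩
    have hgc : ∀ a b, g a - g b ≤ c := by
      intro a b
      rw [hg, ← integral_sub (hfa a).integrable (hfa b).integrable]
      have h1 : ∀ x : Fin n → X, f (Fin.cons a x) - f (Fin.cons b x) ≤ c := by
        intro x
        have := hc (Fin.cons a x) 0 b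
        rwa [Fin.update_cons_zero] at this
      have h2 : Integrable (fun x : Fin n → X => f (Fin.cons a x) - f (Fin.cons b x))
          (Measure.pi fun _ => D) := (hfa a).integrable.sub (hfa b).integrable
      simpa using integral_mono h2 (integrable_const c) h1
    have hfE : BoundedFun fun x => Real.exp (l * (f x - E)) := ((hf.sub_const E).const_mul l).exp
    rw [integral_pi_succ D hfE]
    calc ∫ a, ∫ x, Real.exp (l * (f (Fin.cons a x) - E)) ∂Measure.pi (fun _ : Fin n => D) ∂D
        ≤ ∫ a, Real.exp (l * (g a - E)) * Real.exp (n * (l ^ 2 * c ^ 2 / 8)) ∂D := by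
          refine integral_mono ?_ ?_ fun a => ?_
          · obtain ⟨B, hB⟩ := hfE
            exact BoundedFun.integrable ⟨B, fun a => abs_integral_le_of_abs_le fun x => hB _⟩
          · exact (((hgb.sub_const E).const_mul l).exp.integrable).mul_const _
          · have hsplit : ∀ x : Fin n → X, Real.exp (l * (f (Fin.cons a x) - E))
                = Real.exp (l * (g a - E)) * Real.exp (l * (f (Fin.cons a x) - g a)) := by
              intro x
              rw [← Real.exp_add]
              ring_nf
            simp_rw [hsplit, integral_const_mul]
            refine mul_le_mul_of_nonneg_left (ih (hfa a) fun x i b => ?_) (Real.exp_pos _).le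
            have := hc (Fin.cons a x) i.succ b
            rwa [← Fin.cons_update] at this
      _ ≤ Real.exp (l ^ 2 * c ^ 2 / 8) * Real.exp (n * (l ^ 2 * c ^ 2 / 8)) := by
          rw [integral_mul_const, hEg]
          exact mul_le_mul_of_nonneg_right (integral_exp_le_of_oscillation_le D hgc l)
            (Real.exp_pos _).le
      _ = Real.exp ((n + 1 : ℕ) * (l ^ 2 * c ^ 2 / 8)) := by
          rw [← Real.exp_add]
          push_cast
          ring_nf

/-- McDiarmid's inequality for bounded differences `1 / n`. -/
lemma measureReal_ge_le_of_bounded_differences (D : Measure X) [IsProbabilityMeasure D] {n : ℕ}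
    (hn : 0 < n) {f : (Fin n → X) → ℝ} (hf : BoundedFun f)
    (hc : ∀ x i a, f x - f (Function.update x i a) ≤ 1 / n) {s : ℝ} (hs : 0 ≤ s) :
    (Measure.pi fun _ : Fin n => D).real
        {x | s ≤ f x - ∫ y, f y ∂Measure.pi (fun _ => D)} ≤ Real.exp (-(2 * n * s ^ 2)) := by
  set E := ∫ y, f y ∂Measure.pi (fun _ : Fin n => D) with hE
  have hn' : (0 : ℝ) < n := by exact_mod_cast hn
  -- the minimizer of `- l * s + l ^ 2 / (8 * n)`
  set l : ℝ := 4 * n * s with hl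
  have h1 := ProbabilityTheory.measure_ge_le_exp_mul_mgf (μ := Measure.pi fun _ : Fin n => D)
    (X := fun x => f x - E) (t := l) s (by positivity)
    (((hf.sub_const E).const_mul l).exp.integrable)
  have h2 := integral_exp_le_of_bounded_differences D hf hc l
  refine h1.trans ((mul_le_mul_of_nonneg_left h2 (Real.exp_pos _).le).trans ?_)
  rw [← Real.exp_add]
  refine Real.exp_le_exp.2 (le_of_eq ?_)
  rw [hl]
  field_simp
  ring

end Countable

/-! ### Symmetrization -/

/-- Exchanging the two entries of each pair whose sign `sgn (σ i)` is `-1`. -/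
def swapPairs {X : Type*} {n : ℕ} (σ : Fin n → Bool) (w : Fin n → X × X) : Fin n → X × X :=
  fun i => if σ i then w i else (w i).swap

lemma measurePreserving_swapPairs {X : Type*} [MeasurableSpace X] (D : Measure X)
    [IsProbabilityMeasure D] {n : ℕ} (σ : Fin n → Bool) :
    MeasurePreserving (swapPairs σ) (Measure.pi fun _ : Fin n => D.prod D)
      (Measure.pi fun _ : Fin n => D.prod D) := by
  refine measurePreserving_pi (fun _ => D.prod D) (fun _ => D.prod D)
    (f := fun i p => if σ i then p else p.swap) fun i => ?_
  cases σ i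
  · simpa using Measure.measurePreserving_swap (μ := D) (ν := D)
  · exact MeasurePreserving.id (D.prod D)

/-- Symmetrization: the expected one-sided deviation is at most twice the Rademacher average. -/
lemma integral_iSup_deviation_le {X : Type*} [Countable X] [MeasurableSpace X]
    [MeasurableSingletonClass X] (D : Measure X) [IsProbabilityMeasure D] {T : Type*} [Nonempty T]
    {F : T → X → ℝ} {B : ℝ} (hF : ∀ t x, |F t x| ≤ B) {n : ℕ} {R : ℝ}
    (hR : ∀ x : Fin n → X, 𝔼 σ : Fin n → Bool, ⨆ t, ∑ i, sgn (σ i) * F t (x i) ≤ R) :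
    ∫ x, ⨆ t, (n * (∫ a, F t a ∂D) - ∑ i, F t (x i)) ∂Measure.pi (fun _ : Fin n => D)
      ≤ 2 * R := by
  set μ := Measure.pi fun _ : Fin n => D with hμ
  have hFx : ∀ a, BoundedFun fun t => F t a := fun a => ⟨B, fun t => hF t a⟩
  -- the deviation between two independent samples
  set K : (Fin n → X) × (Fin n → X) → ℝ := fun p => ⨆ t, ∑ i, (F t (p.2 i) - F t (p.1 i)) with hK
  have hterm : ∀ (p : (Fin n → X) × (Fin n → X)) t,
      |∑ i, (F t (p.2 i) - F t (p.1 i))| ≤ n * (2 * B) := by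
    intro p t
    calc |∑ i, (F t (p.2 i) - F t (p.1 i))| ≤ ∑ i, |F t (p.2 i) - F t (p.1 i)| :=
          abs_sum_le_sum_abs _ _
      _ ≤ ∑ _i : Fin n, 2 * B := sum_le_sum fun i _ => by
          have h1 := abs_le.1 (hF t (p.2 i))
          have h2 := abs_le.1 (hF t (p.1 i))
          exact abs_le.2 ⟨by linarith, by linarith⟩
      _ = n * (2 * B) := by simp
  have hKle : ∀ p t, ∑ i, (F t (p.2 i) - F t (p.1 i)) ≤ K p := fun p t =>
    le_ciSup (BoundedFun.bddAbove ⟨n * (2 * B), hterm p⟩) t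
  have hKb : ∀ p, |K p| ≤ n * (2 * B) := by
    intro p
    refine abs_le.2 ⟨?_, ciSup_le fun t => (abs_le.1 (hterm p t)).2⟩
    obtain ⟨t⟩ := ‹Nonempty T›
    exact (abs_le.1 (hterm p t)).1.trans (hKle p t)
  have hint : ∀ t, Integrable (F t) D := fun t => BoundedFun.integrable ⟨B, hF t⟩
  have hghost : ∀ x, ⨆ t, (n * (∫ a, F t a ∂D) - ∑ i, F t (x i)) ≤ ∫ y, K (x, y) ∂μ := by
    intro x
    refine ciSup_le fun t => ?_
    have h1 : n * (∫ a, F t a ∂D) - ∑ i, F t (x i)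
        = ∫ y, ∑ i, (F t (y i) - F t (x i)) ∂μ := by
      rw [integral_finsetSum]
      · have : ∀ i : Fin n, ∫ y, (F t (y i) - F t (x i)) ∂μ = (∫ a, F t a ∂D) - F t (x i) := by
          intro i
          rw [integral_sub (BoundedFun.integrable ⟨B, fun y => hF t _⟩) (integrable_const _),
            hμ, integral_comp_eval (μ := fun _ : Fin n => D) (hint t).aestronglyMeasurable]
          simp
        simp [this]
      · exact fun i _ => (BoundedFun.integrable ⟨B, fun y => hF t _⟩).sub (integrable_const _)
    rw [h1]
    exact integral_mono (BoundedFun.integrable ⟨_, fun y => hterm (x, y) t⟩)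
      (BoundedFun.integrable ⟨_, fun y => hKb (x, y)⟩) fun y => hKle (x, y) t
  set ν := Measure.pi fun _ : Fin n => D.prod D with hν
  have hsign : ∀ σ : Fin n → Bool, ∫ p, K p ∂μ.prod μ
      = ∫ w, K (fun i => (swapPairs σ w i).1, fun i => (swapPairs σ w i).2) ∂ν := by
    intro σ
    have h1 := integral_comp_of_measurePreserving
      (measurePreserving_arrowProdEquivProdArrow X X (Fin n) (fun _ => D) fun _ => D) K
    rw [hμ, ← h1]
    exact (integral_comp_of_measurePreserving (measurePreserving_swapPairs D σ) fun w =>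
      K (MeasurableEquiv.arrowProdEquivProdArrow X X (Fin n) w)).symm
  have hbdd : ∀ (σ : Fin n → Bool) (x : Fin n → X),
      BddAbove (Set.range fun t => ∑ i, sgn (σ i) * F t (x i)) := fun σ x =>
    (BoundedFun.sum fun i _ => (hFx (x i)).const_mul _).bddAbove
  have hpt : ∀ (σ : Fin n → Bool) (w : Fin n → X × X),
      K (fun i => (swapPairs σ w i).1, fun i => (swapPairs σ w i).2)
        ≤ (⨆ t, ∑ i, sgn (σ i) * F t (w i).2) + ⨆ t, ∑ i, sgn (!σ i) * F t (w i).1 := by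
    intro σ w
    refine ciSup_le fun t => ?_
    have h1 := le_ciSup (hbdd σ fun i => (w i).2) t
    have h2 := le_ciSup (hbdd (fun i => !σ i) fun i => (w i).1) t
    refine le_trans (le_of_eq ?_) (add_le_add h1 h2)
    rw [← sum_add_distrib]
    refine sum_congr rfl fun i _ => ?_
    cases h : σ i <;> simp [swapPairs, h] <;> ring
  calc ∫ x, ⨆ t, (n * (∫ a, F t a ∂D) - ∑ i, F t (x i)) ∂μ
      ≤ ∫ x, ∫ y, K (x, y) ∂μ ∂μ := by
        refine integral_mono (BoundedFun.integrable ⟨n * (2 * B), fun x => ?_⟩)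
          (BoundedFun.integrable ⟨n * (2 * B), fun x => abs_integral_le_of_abs_le fun y =>
            hKb (x, y)⟩) hghost
        have h1 : ∀ t, |n * (∫ a, F t a ∂D) - ∑ i, F t (x i)| ≤ n * (2 * B) := by
          intro t
          have h2 := abs_le.1 (abs_integral_le_of_abs_le (μ := D) (hF t))
          have h3 : |∑ i, F t (x i)| ≤ n * B :=
            (abs_sum_le_sum_abs _ _).trans
              ((sum_le_sum fun i _ => hF t (x i)).trans_eq (by simp))
          have h4 := abs_le.1 h3
          have h5 : (0 : ℝ) ≤ n := n.cast_nonneg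
          refine abs_le.2 ⟨?_, ?_⟩ <;> nlinarith
        refine abs_le.2 ⟨?_, ciSup_le fun t => (abs_le.1 (h1 t)).2⟩
        obtain ⟨t⟩ := ‹Nonempty T›
        exact (abs_le.1 (h1 t)).1.trans (le_ciSup (BoundedFun.bddAbove ⟨_, h1⟩) t)
    _ = ∫ p, K p ∂μ.prod μ := (integral_prod K (BoundedFun.integrable ⟨_, hKb⟩)).symm
    _ = 𝔼 σ : Fin n → Bool,
          ∫ w, K (fun i => (swapPairs σ w i).1, fun i => (swapPairs σ w i).2) ∂ν := by
        simp_rw [← hsign]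
        exact (Fintype.expect_const _).symm
    _ = ∫ w, 𝔼 σ : Fin n → Bool,
          K (fun i => (swapPairs σ w i).1, fun i => (swapPairs σ w i).2) ∂ν := by
        simp_rw [Fintype.expect_eq_sum_div_card]
        rw [integral_div, integral_finsetSum]
        exact fun σ _ => BoundedFun.integrable ⟨_, fun w => hKb _⟩
    _ ≤ ∫ _w, 2 * R ∂ν := by
        refine integral_mono (BoundedFun.integrable ⟨n * (2 * B), fun w => ?_⟩)
          (integrable_const _) fun w => ?_
        · refine (abs_expect_le _ _).trans (expect_le univ_nonempty fun σ _ => hKb _)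
        · refine (expect_le_expect fun σ _ => hpt σ w).trans ?_
          rw [expect_add_distrib, expect_not fun σ => ⨆ t, ∑ i, sgn (σ i) * F t (w i).1]
          have h1 := hR fun i => (w i).1
          have h2 := hR fun i => (w i).2
          linarith
    _ = 2 * R := by simp

/-! ### Uniform deviations of a bounded function class -/

/-- The uniform one-sided deviation exceeds twice the Rademacher average by `s` with probability at
most `exp (-2 n s²)`. -/
lemma measureReal_deviation_le {X : Type*} [Countable X] [MeasurableSpace X]
    [MeasurableSingletonClass X] (D : Measure X) [IsProbabilityMeasure D] {T : Type*} [Nonempty T]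
    {F : T → X → ℝ} {B : ℝ} (hF : ∀ t x, |F t x| ≤ B) (hosc : ∀ t x y, F t x - F t y ≤ 1)
    {n : ℕ} (hn : 0 < n) {R : ℝ}
    (hR : ∀ x : Fin n → X, 𝔼 σ : Fin n → Bool, ⨆ t, ∑ i, sgn (σ i) * F t (x i) ≤ R)
    {s : ℝ} (hs : 0 ≤ s) :
    (Measure.pi fun _ : Fin n => D).real
        {x | ∃ t, 2 * R / n + s ≤ (∫ a, F t a ∂D) - 1 / n * ∑ i, F t (x i)}
      ≤ Real.exp (-(2 * n * s ^ 2)) := by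
  have hn' : (0 : ℝ) < n := by exact_mod_cast hn
  set f : (Fin n → X) → ℝ := fun x => ⨆ t, ((∫ a, F t a ∂D) - 1 / n * ∑ i, F t (x i)) with hf
  have hterm : ∀ (x : Fin n → X) t, |(∫ a, F t a ∂D) - 1 / n * ∑ i, F t (x i)| ≤ 2 * B := by
    intro x t
    have h2 := abs_le.1 (abs_integral_le_of_abs_le (μ := D) (hF t))
    have h3 : |1 / n * ∑ i, F t (x i)| ≤ B := by
      rw [abs_mul, abs_of_pos (by positivity : (0 : ℝ) < 1 / n), one_div, inv_mul_le_iff₀ hn']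
      exact (abs_sum_le_sum_abs _ _).trans ((sum_le_sum fun i _ => hF t (x i)).trans_eq (by simp))
    have h4 := abs_le.1 h3
    exact abs_le.2 ⟨by linarith, by linarith⟩
  have hle : ∀ (x : Fin n → X) t, (∫ a, F t a ∂D) - 1 / n * ∑ i, F t (x i) ≤ f x := fun x t =>
    le_ciSup (BoundedFun.bddAbove ⟨_, hterm x⟩) t
  have hfb : BoundedFun f := by
    refine ⟨2 * B, fun x => abs_le.2 ⟨?_, ciSup_le fun t => (abs_le.1 (hterm x t)).2⟩⟩
    obtain ⟨t⟩ := ‹Nonempty T›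
    exact (abs_le.1 (hterm x t)).1.trans (hle x t)
  have hmean : ∫ x, f x ∂Measure.pi (fun _ => D) ≤ 2 * R / n := by
    have hscale : ∀ x, f x
        = 1 / n * ⨆ t, (n * (∫ a, F t a ∂D) - ∑ i, F t (x i)) := by
      intro x
      rw [Real.mul_iSup_of_nonneg (by positivity), hf]
      refine iSup_congr fun t => ?_
      field_simp
    simp_rw [hscale]
    rw [integral_const_mul, one_div, inv_mul_le_iff₀ hn', mul_div_cancel₀ _ hn'.ne']
    exact integral_iSup_deviation_le D hF hR
  have hdiff : ∀ x i a, f x - f (Function.update x i a) ≤ 1 / n := by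
    intro x i a
    rw [sub_le_iff_le_add]
    refine ciSup_le fun t => ?_
    have h1 := hle (Function.update x i a) t
    have h2 : ∑ j, F t (Function.update x i a j) - ∑ j, F t (x j) = F t a - F t (x i) := by
      rw [← sum_sub_distrib, sum_eq_single i]
      · simp
      · intro j _ hj
        simp [Function.update_of_ne hj]
      · simp
    have h3 : 1 / (n : ℝ) * (F t a - F t (x i)) ≤ 1 / n * 1 :=
      mul_le_mul_of_nonneg_left (hosc t a (x i)) (by positivity)
    rw [← h2] at h3
    linarith
  refine le_trans (measureReal_mono ?_) (measureReal_ge_le_of_bounded_differences D hn hfb hdiff hs)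
  rintro x ⟨t, ht⟩
  have := hle x t
  simp only [Set.mem_ofPred_eq]
  linarith

/-! ### The adversarial loss class -/

variable {X Z : Type*} {H : Set (Z → Bool)}

/-- If the error sets of `H` on labelled points shatter a set, then `H` induces all labellings of
the points in it. -/
lemma card_le_vcDim_of_shatters {ι : Type*} [DecidableEq ι] {d : ℕ} (hd : vcDim H = d)
    (z : ι → Z) (y : ι → Bool) {P : Finset (Finset ι)}
    (hP : ∀ A ∈ P, ∃ h ∈ H, ∀ p, p ∈ A ↔ h (z p) ≠ y p) {t : Finset ι} (ht : P.Shatters t) :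
    #t ≤ d := by
  set e : Fin #t ≃ t := t.equivFin.symm with he
  have hncard : ∀ w : Fin #t → Z,
      Set.ncard {b : Fin #t → Bool | ∃ h ∈ H, ∀ i, b i = h (w i)} ≤ 2 ^ #t := by
    intro w
    refine (Set.ncard_le_ncard (Set.subset_univ _)).trans ?_
    simp [Set.ncard_univ]
  have hall : {b : Fin #t → Bool | ∃ h ∈ H, ∀ i, b i = h (z (e i))} = Set.univ := by
    refine Set.eq_univ_of_forall fun b => ?_
    obtain ⟨A, hA, htA⟩ := ht (filter_subset
      (fun p => ∃ hp : p ∈ t, b (e.symm ⟨p, hp⟩) ≠ y p) t)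
    obtain ⟨h, hH, hAh⟩ := hP A hA
    refine ⟨h, hH, fun i => ?_⟩
    have hmem := congrArg (fun s => ((e i : t) : ι) ∈ s) htA
    simp only [mem_inter, mem_filter, (e i).2, true_and, exists_true_left, hAh, Subtype.coe_eta,
      Equiv.symm_apply_apply, eq_iff_iff] at hmem
    revert hmem
    cases b i <;> cases h (z (e i)) <;> cases y (e i) <;> simp
  have hgrowth : growth H #t = 2 ^ #t := by
    have hne : Nonempty (Fin #t → Z) := ⟨fun i => z (e i)⟩
    refine le_antisymm (ciSup_le hncard) ?_
    refine le_trans (le_of_eq ?_) (le_ciSup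
      (f := fun w : Fin #t → Z => Set.ncard {b : Fin #t → Bool | ∃ h ∈ H, ∀ i, b i = h (w i)})
      ⟨2 ^ #t, by rintro _ ⟨w, rfl⟩; exact hncard w⟩ fun i => z (e i))
    simp only [hall]
    simp [Set.ncard_univ]
  have hle : (#t : ℕ∞) ≤ vcDim H :=
    le_iSup₂ (f := fun (m : ℕ) (_ : m ∈ {m : ℕ | growth H m = 2 ^ m}) => (m : ℕ∞)) #t hgrowth
  rw [hd] at hle
  exact_mod_cast hle

lemma zeroOneLoss_mem_Icc (y y' : Bool) : zeroOneLoss y y' ∈ Set.Icc (0 : ℝ) 1 := by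
  unfold zeroOneLoss
  split_ifs <;> simp

lemma Mixture.loss_mem_Icc (q : Mixture H) (z : Z) (y : Bool) : q.loss z y ∈ Set.Icc (0 : ℝ) 1 := by
  refine ⟨sum_nonneg fun t _ => mul_nonneg (q.weight_nonneg t) (zeroOneLoss_mem_Icc _ _).1, ?_⟩
  rw [← q.weight_sum]
  exact sum_le_sum fun t _ => mul_le_of_le_one_right (q.weight_nonneg t) (zeroOneLoss_mem_Icc _ _).2

lemma Mixture.advLoss_mem_Icc (q : Mixture H) (ρ : X → Finset Z) (hρ : ∀ x, (ρ x).Nonempty) (x : X)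
    (y : Bool) : q.advLoss ρ hρ x y ∈ Set.Icc (0 : ℝ) 1 := by
  obtain ⟨z, -, hz⟩ := exists_mem_eq_sup' (hρ x) fun z => q.loss z y
  rw [Mixture.advLoss, hz]
  exact q.loss_mem_Icc z y

/-- A maximum of coordinates is `1`-Lipschitz for the Euclidean distance. -/
lemma Mixture.advLoss_sub_le (q q' : Mixture H) (ρ : X → Finset Z) (hρ : ∀ x, (ρ x).Nonempty)
    (x : X) (y : Bool) {k : ℕ} {e : Fin k → Z} (he : ∀ z ∈ ρ x, ∃ j, e j = z) :
    q.advLoss ρ hρ x y - q'.advLoss ρ hρ x y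
      ≤ √(∑ j, (q.loss (e j) y - q'.loss (e j) y) ^ 2) := by
  obtain ⟨z, hz, hzq⟩ := exists_mem_eq_sup' (hρ x) fun z => q.loss z y
  have hq' : q'.loss z y ≤ q'.advLoss ρ hρ x y := le_sup' (fun z => q'.loss z y) hz
  obtain ⟨j, rfl⟩ := he z hz
  refine le_trans ?_ (Real.le_sqrt_of_sq_le (single_le_sum
    (f := fun j => (q.loss (e j) y - q'.loss (e j) y) ^ 2) (fun j _ => sq_nonneg _) (mem_univ j)))
  rw [Mixture.advLoss, hzq]
  linarith

/-- A Rademacher sum over mixtures is linear in the mixture, so that it is at most the maximum over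
single hypotheses, which the VC dimension controls. -/
lemma expect_iSup_loss_le [Nonempty (Mixture H)] {d : ℕ} (hd : vcDim H = d) {ι : Type*} [Fintype ι]
    [DecidableEq ι] (z : ι → Z) (y : ι → Bool) :
    𝔼 σ : ι → Bool, ⨆ q : Mixture H, ∑ p, sgn (σ p) * q.loss (z p) (y p)
      ≤ 17 * √(d * Fintype.card ι) := by
  classical
  set E : (Z → Bool) → Finset ι := fun h => univ.filter fun p => h (z p) ≠ y p with hE
  set P : Finset (Finset ι) := univ.filter fun A => ∃ h ∈ H, E h = A with hP
  have hmem : ∀ h ∈ H, E h ∈ P := fun h hh => mem_filter.2 ⟨mem_univ _, h, hh, rfl⟩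
  have hne : P.Nonempty := by
    obtain ⟨q⟩ := ‹Nonempty (Mixture H)›
    have : Nonempty (Fin q.size) := by
      by_contra hempty
      rw [not_nonempty_iff] at hempty
      have := q.weight_sum
      simp at this
    obtain ⟨t⟩ := this
    exact ⟨_, hmem _ (q.hyp_mem t)⟩
  have hshat : ∀ t, P.Shatters t → #t ≤ d := fun t ht => by
    refine card_le_vcDim_of_shatters hd z y (fun A hA => ?_) ht
    obtain ⟨-, h, hh, rfl⟩ := mem_filter.1 hA
    exact ⟨h, hh, fun p => by simp [hE]⟩
  refine le_trans (expect_le_expect fun σ _ => ciSup_le fun q => ?_) (expect_sup'_ind_le P hne hshat)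
  set M := P.sup' hne fun A => ∑ p, sgn (σ p) * ind A p with hM
  calc ∑ p, sgn (σ p) * q.loss (z p) (y p)
      = ∑ t, q.weight t * ∑ p, sgn (σ p) * ind (E (q.hyp t)) p := by
        simp_rw [Mixture.loss, mul_sum]
        rw [sum_comm]
        refine sum_congr rfl fun t _ => sum_congr rfl fun p _ => ?_
        simp only [zeroOneLoss, ind, hE, mem_filter, mem_univ, true_and]
        ring
    _ ≤ ∑ t, q.weight t * M := by
        refine sum_le_sum fun t _ => mul_le_mul_of_nonneg_left ?_ (q.weight_nonneg t)
        exact le_sup' (fun A => ∑ p, sgn (σ p) * ind A p) (hmem _ (q.hyp_mem t))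
    _ = M := by rw [← sum_mul, q.weight_sum, one_mul]

/-- The Rademacher average of the adversarial loss class is `O(√(d n k))`: vector contraction
replaces each maximum by its at most `k` coordinates. -/
lemma expect_iSup_advLoss_le [Nonempty (Mixture H)] {d : ℕ} (hd : vcDim H = d) {ρ : X → Finset Z}
    (hρ : ∀ x, (ρ x).Nonempty) {k : ℕ} (hk : ∀ x, #(ρ x) ≤ k) (c : X → Bool) (b : Bool) {n : ℕ}
    (x : Fin n → X) :
    𝔼 σ : Fin n → Bool, ⨆ q : Mixture H,
        ∑ i, sgn (σ i) * (sgn b * q.advLoss ρ hρ (x i) (c (x i)))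
      ≤ 34 * √(d * (n * k)) := by
  -- an enumeration of each `ρ a` by `Fin k`, with repetitions if `ρ a` has fewer than `k` elements
  have henum : ∀ a, ∃ e : Fin k → Z, ∀ z ∈ ρ a, ∃ j, e j = z := by
    intro a
    obtain ⟨z₀, -⟩ := hρ a
    refine ⟨fun j => if h : (j : ℕ) < #(ρ a) then (ρ a).equivFin.symm ⟨j, h⟩ else z₀,
      fun z hz => ?_⟩
    have hlt := ((ρ a).equivFin ⟨z, hz⟩).2
    exact ⟨⟨(ρ a).equivFin ⟨z, hz⟩, hlt.trans_le (hk a)⟩, by simp⟩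
  choose e he using henum
  have hcontr := expect_iSup_contraction (T := Mixture H) (n := n) (k := k) (g := fun _ => 0)
    (ψ := fun i q => sgn b * q.advLoss ρ hρ (x i) (c (x i)))
    (v := fun i q j => q.loss (e (x i) j) (c (x i)))
    (fun i => BoundedFun.const_mul ⟨1, fun q => by
      have := q.advLoss_mem_Icc ρ hρ (x i) (c (x i))
      rw [abs_of_nonneg this.1]
      exact this.2⟩ _)
    (fun i j => ⟨1, fun q => by
      have := q.loss_mem_Icc (e (x i) j) (c (x i))
      rw [abs_of_nonneg this.1]
      exact this.2⟩)
    ⟨0, fun _ => by simp⟩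
    (fun i q q' => by
      rcases sgn_eq_or b with hb | hb
      · simpa [hb] using q.advLoss_sub_le q' ρ hρ (x i) (c (x i)) (he (x i))
      · have := q'.advLoss_sub_le q ρ hρ (x i) (c (x i)) (he (x i))
        simp_rw [sub_sq_comm (q'.loss _ _)] at this
        rw [hb]
        linarith)
  simp only [add_zero] at hcontr
  refine hcontr.trans ?_
  have hvc := expect_iSup_loss_le (H := H) hd (fun p : Fin n × Fin k => e (x p.1) p.2)
    fun p => c (x p.1)
  calc 𝔼 τ : Fin n → Fin k → Bool, ⨆ q : Mixture H,
        ∑ i, 2 * ∑ j, sgn (τ i j) * q.loss (e (x i) j) (c (x i))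
      = 𝔼 σ : Fin n × Fin k → Bool, 2 * ⨆ q : Mixture H,
          ∑ p, sgn (σ p) * q.loss (e (x p.1) p.2) (c (x p.1)) := by
        refine (Fintype.expect_equiv (Equiv.curry _ _ _) _ _ fun σ => ?_).symm
        rw [Real.mul_iSup_of_nonneg (by norm_num)]
        refine iSup_congr fun q => ?_
        rw [← mul_sum, Fintype.sum_prod_type]
        rfl
    _ ≤ 2 * (17 * √(d * Fintype.card (Fin n × Fin k))) := by
        rw [← mul_expect]
        gcongr
    _ = 34 * √(d * (n * k)) := by
        simp only [Fintype.card_prod, Fintype.card_fin, Nat.cast_mul]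
        ring

/-- One side of the deviation of the empirical risk from the risk; the sign `sgn b` selects the
side. -/
lemma measureReal_risk_deviation_le [Countable X] [MeasurableSpace X] [MeasurableSingletonClass X]
    [Nonempty (Mixture H)] {d : ℕ} (hd : vcDim H = d) {ρ : X → Finset Z}
    (hρ : ∀ x, (ρ x).Nonempty) {k : ℕ} (hk : ∀ x, #(ρ x) ≤ k) (D : Measure X)
    [IsProbabilityMeasure D] (c : X → Bool) (b : Bool) {n : ℕ} (hn : 0 < n) {ε : ℝ} (hε : 0 < ε)
    (hdk : 20000 * (d * k) ≤ ε ^ 2 * n) :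
    (Measure.pi fun _ : Fin n => D).real {x | ∃ q : Mixture H,
        ε ≤ sgn b * (q.risk ρ hρ D c - q.empRisk ρ hρ (labelledSample c x))}
      ≤ Real.exp (-(n * ε ^ 2 / 2)) := by
  have hn' : (0 : ℝ) < n := by exact_mod_cast hn
  have hdev := measureReal_deviation_le D (T := Mixture H) (B := 1) (s := ε / 2)
    (F := fun q a => sgn b * q.advLoss ρ hρ a (c a))
    (fun q a => by
      have := q.advLoss_mem_Icc ρ hρ a (c a)
      rcases sgn_eq_or b with hb | hb <;> rw [hb] <;> refine abs_le.2 ⟨?_, ?_⟩ <;>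
        linarith [this.1, this.2])
    (fun q a a' => by
      have h1 := q.advLoss_mem_Icc ρ hρ a (c a)
      have h2 := q.advLoss_mem_Icc ρ hρ a' (c a')
      rcases sgn_eq_or b with hb | hb <;> rw [hb] <;> linarith [h1.1, h1.2, h2.1, h2.2])
    hn (expect_iSup_advLoss_le hd hρ hk c b) (by positivity)
  have hR : 2 * (34 * √(d * (n * k))) / n ≤ ε / 2 := by
    have hroot : √(d * (n * k)) ≤ ε * n / 136 := by
      refine Real.sqrt_le_iff.2 ⟨by positivity, ?_⟩
      have := mul_le_mul_of_nonneg_right hdk hn'.le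
      have h0 : (0 : ℝ) ≤ d * k * n := by positivity
      nlinarith
    rw [div_le_iff₀ hn']
    linarith
  refine (measureReal_mono ?_).trans (hdev.trans_eq ?_)
  · rintro x ⟨q, hq⟩
    refine ⟨q, ?_⟩
    have hrisk : (∫ a, sgn b * q.advLoss ρ hρ a (c a) ∂D)
        - 1 / n * ∑ i, sgn b * q.advLoss ρ hρ (x i) (c (x i))
        = sgn b * (q.risk ρ hρ D c - q.empRisk ρ hρ (labelledSample c x)) := by
      rw [integral_const_mul, ← mul_sum]
      simp only [Mixture.risk, Mixture.empRisk, labelledSample]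
      ring
    rw [hrisk]
    linarith
  · congr 1
    ring

lemma uniformlyClose_of_le [Countable X] [MeasurableSpace X] [MeasurableSingletonClass X] {d : ℕ}
    (hd : vcDim H = d) {ρ : X → Finset Z} (hρ : ∀ x, (ρ x).Nonempty) {k : ℕ}
    (hk : ∀ x, #(ρ x) ≤ k) (D : Measure X) [IsProbabilityMeasure D] (c : X → Bool) {n : ℕ}
    {ε δ : ℝ} (hε : 0 < ε) (hδ : 0 < δ) (hδ1 : δ < 1)
    (h : 20000 * (1 / ε ^ 2 * (k * Real.log (3 * k) * d + Real.log (2 / δ))) ≤ n) :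
    UniformlyClose H ρ hρ D c ε δ n := by
  unfold UniformlyClose
  rcases isEmpty_or_nonempty (Mixture H) with hempty | hne
  · have : {x : Fin n → X | ∀ q : Mixture H,
        |q.risk ρ hρ D c - q.empRisk ρ hρ (labelledSample c x)| ≤ ε} = Set.univ :=
      Set.eq_univ_of_forall fun x q => (hempty.false q).elim
    rw [this, measure_univ]
    exact ENNReal.ofReal_le_one.2 (by linarith)
  have hk1 : (1 : ℝ) ≤ k := by
    obtain ⟨a⟩ : Nonempty X := D.nonempty_of_neZero
    exact_mod_cast (hρ a).card_pos.trans_le (hk a)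
  have hlog3 : 1 ≤ Real.log (3 * k) := by
    rw [Real.le_log_iff_exp_le (by positivity)]
    linarith [Real.exp_one_lt_d9]
  have hlogδ : 0 < Real.log (2 / δ) := Real.log_pos (by rw [lt_div_iff₀ hδ]; linarith)
  have hε2 : 0 < ε ^ 2 := by positivity
  have h' : 20000 * (k * Real.log (3 * k) * d + Real.log (2 / δ)) ≤ ε ^ 2 * n := by
    have := mul_le_mul_of_nonneg_left h hε2.le
    refine le_trans (le_of_eq ?_) this
    field_simp
  have hkd : (d : ℝ) * k ≤ k * Real.log (3 * k) * d := by
    have := mul_le_mul_of_nonneg_left hlog3 (by positivity : (0 : ℝ) ≤ d * k)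
    linarith
  have hn : 0 < n := by
    rw [Nat.pos_iff_ne_zero]
    rintro rfl
    have : (0 : ℝ) ≤ d * k := by positivity
    rw [Nat.cast_zero, mul_zero] at h'
    linarith
  have htail : Real.exp (-(n * ε ^ 2 / 2)) ≤ δ / 2 := by
    have hinv : Real.log (δ / 2) = -Real.log (2 / δ) := by rw [← Real.log_inv, inv_div]
    rw [← Real.le_log_iff_exp_le (by positivity), hinv]
    have : (0 : ℝ) ≤ d * k := by positivity
    linarith
  set bad : Bool → Set (Fin n → X) := fun b => {x | ∃ q : Mixture H,
    ε ≤ sgn b * (q.risk ρ hρ D c - q.empRisk ρ hρ (labelledSample c x))} with hbad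
  have hb : ∀ b, (Measure.pi fun _ : Fin n => D).real (bad b) ≤ δ / 2 := fun b =>
    (measureReal_risk_deviation_le hd hρ hk D c b hn hε (by linarith)).trans htail
  have hgood : (bad true ∪ bad false)ᶜ ⊆ {x | ∀ q : Mixture H,
      |q.risk ρ hρ D c - q.empRisk ρ hρ (labelledSample c x)| ≤ ε} := by
    intro x hx q
    simp only [hbad, Set.mem_compl_iff, Set.mem_union, Set.mem_ofPred_eq, not_or, not_exists,
      not_le, sgn_true, sgn_false] at hx
    have h1 := hx.1 q
    have h2 := hx.2 q
    exact abs_le.2 ⟨by linarith, by linarith⟩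
  refine le_trans ?_ (measure_mono hgood)
  rw [← ofReal_measureReal]
  refine ENNReal.ofReal_le_ofReal ?_
  rw [probReal_compl_eq_one_sub (MeasurableSet.of_discrete)]
  have := measureReal_union_le (μ := Measure.pi fun _ : Fin n => D) (bad true) (bad false)
  linarith [hb true, hb false]

/-- Up to the factor `4`, the sample size bound for `k ≥ 2` implies the unrestricted one. -/
lemma sample_size_le {k d : ℕ} {δ : ℝ} (hk : 2 ≤ k) (hδ : 0 < δ) (hδ1 : δ < 1)
    (hdδ : 1 ≤ d ∨ δ ≤ 1 / 2) :
    k * Real.log (3 * k) * d + Real.log (2 / δ)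
      ≤ 4 * (k * Real.log k * d + Real.log (1 / δ)) := by
  have hk' : (2 : ℝ) ≤ k := by exact_mod_cast hk
  have hlog2 : Real.log 2 ≤ Real.log k := Real.log_le_log (by norm_num) hk'
  have hlog2pos : 0 < Real.log 2 := Real.log_pos (by norm_num)
  have hlog3 : Real.log 3 ≤ 2 * Real.log 2 := by
    rw [← Real.log_rpow (by norm_num)]
    exact Real.log_le_log (by norm_num) (by norm_num)
  have h1 : Real.log (3 * k) ≤ 3 * Real.log k := by
    rw [Real.log_mul (by norm_num) (by positivity)]
    linarith
  have h2 : k * Real.log (3 * k) * d ≤ k * (3 * Real.log k) * d := by gcongr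
  have h3 : Real.log (2 / δ) = Real.log 2 + Real.log (1 / δ) := by
    rw [← Real.log_mul (by norm_num) (by positivity)]
    ring_nf
  have h4 : 0 ≤ Real.log (1 / δ) := Real.log_nonneg (by rw [le_div_iff₀ hδ]; linarith)
  have h5 : 0 ≤ k * Real.log k * d := by
    have : 0 ≤ Real.log k := by linarith
    positivity
  have h6 : Real.log 2 ≤ k * Real.log k * d + Real.log (1 / δ) := by
    rcases hdδ with hd | hδ2
    · have hd' : (1 : ℝ) ≤ d := by exact_mod_cast hd
      have : Real.log 2 ≤ k * Real.log k * d := by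
        have h7 : 1 * Real.log 2 * 1 ≤ k * Real.log k * d := by gcongr; linarith
        linarith
      linarith
    · have : Real.log 2 ≤ Real.log (1 / δ) :=
        Real.log_le_log (by norm_num) (by rw [le_div_iff₀ hδ]; linarith)
      linarith
  linarith

end RobustLearning

theorem mainTheorem1 :
    ∃ C : ℝ, 0 < C ∧
      ∀ (X : Type*) (Z : Type*) [Countable X] [MeasurableSpace X] [MeasurableSingletonClass X]
        (H : Set (Z → Bool)) (d : ℕ), RobustLearning.vcDim H = (d : ℕ∞) →
      ∀ (k : ℕ) (ε δ : ℝ), 0 < ε → 0 < δ → δ < 1 →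
      ∀ n : ℕ,
        ((2 ≤ k ∧ (1 ≤ d ∨ δ ≤ 1 / 2) ∧
            C * (1 / ε ^ 2 * (k * Real.log k * d + Real.log (1 / δ))) ≤ n) ∨
          C * (1 / ε ^ 2 * (k * Real.log (3 * k) * d + Real.log (2 / δ))) ≤ n) →
      ∀ (D : MeasureTheory.Measure X) [MeasureTheory.IsProbabilityMeasure D]
        (c : X → Bool) (ρ : X → Finset Z) (hρ : ∀ x, (ρ x).Nonempty),
        (∀ x, (ρ x).card ≤ k) →
        RobustLearning.UniformlyClose H ρ hρ D c ε δ n := by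
  refine ⟨80000, by norm_num, ?_⟩
  intro X Z _ _ _ H d hd k ε δ hε hδ hδ1 n hn D _ c ρ hρ hk
  refine RobustLearning.uniformlyClose_of_le hd hρ hk D c hε hδ hδ1 ?_
  have hε2 : 0 < 1 / ε ^ 2 := by positivity
  rcases hn with ⟨hk2, hdδ, hn⟩ | hn
  · have h := mul_le_mul_of_nonneg_left (RobustLearning.sample_size_le hk2 hδ hδ1 hdδ) hε2.le
    linarith
  · refine le_trans ?_ hn
    have hlogk : 0 ≤ Real.log (3 * k) := by
      exact_mod_cast Real.log_natCast_nonneg (3 * k)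
    have hlogδ : 0 ≤ Real.log (2 / δ) := Real.log_nonneg (by rw [le_div_iff₀ hδ]; linarith)
    gcongr
    norm_num
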